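/- There is an absolute constant $c>0$ with the following property. Let $R$ be a nonempty finite set of closed disks in the plane $\mathbb{R}^2$ (of arbitrary positive radii), and let $Q\subseteq\mathbb{R}^2$ be a set of points such that (a) no point of $Q$ is contained in any disk of $R$, and (b) no face of the complement of the union of the disks, that is, no connected component of $\mathbb{R}^2\setminus\bigcup_{d\in R}d$, contains more than one point of $Q$. Then $Q$ is finite and $|R|\ge c\,|Q|$; in other words, $|R|=\Omega(|Q|)$. -/

import Mathlib

/-- The Euclidean plane. -/
abbrev Plane : Type := EuclideanSpace ℝ (Fin 2)

/-- A disk in the plane: a closed round disk of some positive radius. -/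
def IsDisk (d : Set Plane) : Prop :=
  ∃ (c : Plane) (r : ℝ), 0 < r ∧ d = Metric.closedBall c r

/-- The complement of the union of a family of subsets of the plane. -/
def unionCompl (R : Set (Set Plane)) : Set Plane := (⋃ d ∈ R, d)ᶜ

/-- A face in the complement of the union of `R`: a connected component of that complement. -/
def IsFace (R : Set (Set Plane)) (F : Set Plane) : Prop :=
  ∃ x ∈ unionCompl R, F = connectedComponentIn (unionCompl R) x

/-! The least power over all disks, `minPower`, is continuous and positive exactly off the union, so
each bounded face contains a local maximum of it. There the active centres positively span the plane
around the point (`IsLocalMax.isSurrounded`). Fix a generic slope `s`. Such a point is charged to an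
active disk `p` whose centre is strictly between two other active centres in the functional,
together with a side `σ`. The point is then the unique extreme point of the power cell of `p` in the
direction `σ(-s, 1)`, so the charge is injective (`IsMiddle.eq`). Hence at most `2|R|` points of `Q`
lie in bounded faces. There is at most one unbounded face. -/

/-- The power of the point `y` with respect to the circle of centre `c` and radius `r`. -/
noncomputable def power (c : Plane) (r : ℝ) (y : Plane) : ℝ :=
  (y 0 - c 0) ^ 2 + (y 1 - c 1) ^ 2 - r ^ 2

theorem continuous_power (c : Plane) (r : ℝ) : Continuous (power c r) := by
  unfold power
  fun_prop

theorem power_eq (c : Plane) (r : ℝ) (y : Plane) : power c r y = dist y c ^ 2 - r ^ 2 := by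
  rw [EuclideanSpace.dist_eq, Real.sq_sqrt (by positivity)]
  simp [power, Fin.sum_univ_two, Real.dist_eq, sq_abs]

theorem power_nonpos_iff {c : Plane} {r : ℝ} (hr : 0 < r) {y : Plane} :
    power c r y ≤ 0 ↔ y ∈ Metric.closedBall c r := by
  rw [power_eq, Metric.mem_closedBall, sub_nonpos, sq_le_sq₀ dist_nonneg hr.le]

variable {ι : Type*}

/-- The index `i` realizes the least power of `x` with respect to a family of circles. -/
def IsActive (c : ι → Plane) (r : ι → ℝ) (x : Plane) (i : ι) : Prop :=
  ∀ j, power (c i) (r i) x ≤ power (c j) (r j) x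

/-- The directions from `x` to the centres of the active circles positively span the plane. -/
def IsSurrounded (c : ι → Plane) (r : ι → ℝ) (x : Plane) : Prop :=
  ∀ v0 v1 : ℝ, (v0 ≠ 0 ∨ v1 ≠ 0) →
    ∃ j, IsActive c r x j ∧ 0 < v0 * (c j 0 - x 0) + v1 * (c j 1 - x 1)

/-- The least power of `y` with respect to a finite family of circles. -/
noncomputable def minPower [Fintype ι] [Nonempty ι] (c : ι → Plane) (r : ι → ℝ) (y : Plane) : ℝ :=
  Finset.univ.inf' Finset.univ_nonempty fun i => power (c i) (r i) y

theorem continuous_minPower [Fintype ι] [Nonempty ι] (c : ι → Plane) (r : ι → ℝ) :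
    Continuous (minPower c r) :=
  Continuous.finset_inf'_apply _ fun i _ => continuous_power (c i) (r i)

/-! ### Local maxima of the least power -/

theorem IsLocalMax.isSurrounded [Fintype ι] [Nonempty ι] {c : ι → Plane} {r : ι → ℝ} {x : Plane}
    (hx : IsLocalMax (minPower c r) x) : IsSurrounded c r x := by
  intro v0 v1 hv
  by_contra! hcon
  set v : Plane := !₂[v0, v1] with hvdef
  have hline : Filter.Tendsto (fun t : ℝ => x + t • v) (nhdsWithin 0 (Set.Ioi 0)) (nhds x) := by
    have h : Continuous fun t : ℝ => x + t • v := by fun_prop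
    have := h.tendsto 0
    rw [zero_smul, add_zero] at this
    exact this.mono_left nhdsWithin_le_nhds
  have hgt : ∀ i, ∀ᶠ t : ℝ in nhdsWithin 0 (Set.Ioi 0),
      minPower c r x < power (c i) (r i) (x + t • v) := by
    intro i
    by_cases hi : IsActive c r x i
    · filter_upwards [self_mem_nhdsWithin] with t ht
      have h1 : minPower c r x ≤ power (c i) (r i) x := Finset.inf'_le _ (Finset.mem_univ i)
      have h2 := hcon i hi
      -- The quadratic term makes the power grow strictly even when the centre direction is
      -- orthogonal to `v`.
      have h3 : 0 < v0 ^ 2 + v1 ^ 2 := by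
        rcases hv with h | h <;> positivity
      have ht : 0 < t := ht
      have h4 : power (c i) (r i) (x + t • v) = power (c i) (r i) x
          + t ^ 2 * (v0 ^ 2 + v1 ^ 2)
          - 2 * (t * (v0 * (c i 0 - x 0) + v1 * (c i 1 - x 1))) := by
        simp [power, hvdef]
        ring
      have h5 : 0 < t ^ 2 * (v0 ^ 2 + v1 ^ 2) := by positivity
      have h6 : t * (v0 * (c i 0 - x 0) + v1 * (c i 1 - x 1)) ≤ 0 :=
        mul_nonpos_of_nonneg_of_nonpos ht.le h2
      linarith
    · simp only [IsActive, not_forall, not_le] at hi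
      obtain ⟨j, hj⟩ := hi
      have h1 : minPower c r x ≤ power (c j) (r j) x := Finset.inf'_le _ (Finset.mem_univ j)
      exact (((continuous_power (c i) (r i)).tendsto x).comp hline).eventually_const_lt
        (h1.trans_lt hj)
  obtain ⟨t, ht, ht'⟩ := ((Filter.eventually_all.2 hgt).and (hline.eventually hx)).exists
  obtain ⟨i, -, hi⟩ := Finset.exists_mem_eq_inf' (Finset.univ_nonempty (α := ι))
    fun i => power (c i) (r i) (x + t • v)
  have h1 := ht i
  have h2 : minPower c r (x + t • v) = power (c i) (r i) (x + t • v) := hi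
  linarith

/-! ### Charging surrounded points to disks -/

/-- The difference of the powers for `p` and `i` is affine, nonpositive at `x'` and nonnegative at
`x`. -/
theorem IsActive.inner_sub_nonpos {c : ι → Plane} {r : ι → ℝ} {x x' : Plane} {p i : ι}
    (hp' : IsActive c r x' p) (hi : IsActive c r x i) :
    (x' 0 - x 0) * (c i 0 - c p 0) + (x' 1 - x 1) * (c i 1 - c p 1) ≤ 0 := by
  have h1 := hp' i
  have h2 := hi p
  unfold power at h1 h2
  linarith

/-- The centre of the active circle `p` lies strictly between two active centres with respect to the
linear functional `y ↦ y 0 + s * y 1`, and `σ` tells on which side of the line through these. -/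
def IsMiddle (c : ι → Plane) (r : ι → ℝ) (s : ℝ) (x : Plane) (p : ι) (σ : Bool) : Prop :=
  IsActive c r x p ∧ ∃ a b, IsActive c r x a ∧ IsActive c r x b ∧
    (c a 0 - c p 0) + s * (c a 1 - c p 1) < 0 ∧ 0 < (c b 0 - c p 0) + s * (c b 1 - c p 1) ∧
    0 < (if σ then 1 else -1 : ℝ) *
      ((c b 0 - c p 0) * (c a 1 - c p 1) - (c a 0 - c p 0) * (c b 1 - c p 1))

theorem IsMiddle.eq {c : ι → Plane} {r : ι → ℝ} {s : ℝ} {x x' : Plane} {p : ι} {σ : Bool}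
    (h : IsMiddle c r s x p σ) (h' : IsMiddle c r s x' p σ) : x = x' := by
  have key : ∀ ε d0 d1 a0 a1 b0 b1 : ℝ, a0 + s * a1 < 0 → 0 < b0 + s * b1 →
      0 < ε * (b0 * a1 - a0 * b1) → d0 * a0 + d1 * a1 ≤ 0 → d0 * b0 + d1 * b1 ≤ 0 →
      ε * (d1 - s * d0) ≤ 0 := by
    intro ε d0 d1 a0 a1 b0 b1 ha hb hdet hda hdb
    -- The positive combination of `a` and `b` killed by `(1, s)` is the determinant times `(-s,
    -- 1)`.
    have h1 : (b0 * a1 - a0 * b1) * (d1 - s * d0) ≤ 0 := by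
      have h2 := mul_nonpos_of_nonneg_of_nonpos hb.le hda
      have h3 := mul_nonpos_of_nonneg_of_nonpos (neg_pos.2 ha).le hdb
      linarith
    by_contra! hpos
    have h4 := mul_pos hdet hpos
    have h5 : 0 ≤ ε ^ 2 := sq_nonneg ε
    have h6 := mul_nonpos_of_nonneg_of_nonpos h5 h1
    linarith
  obtain ⟨hp, a, b, ha, hb, hua, hub, hdet⟩ := h
  obtain ⟨hp', a', b', ha', hb', hua', hub', hdet'⟩ := h'
  have hda := hp'.inner_sub_nonpos ha
  have hdb := hp'.inner_sub_nonpos hb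
  have hda' := hp.inner_sub_nonpos ha'
  have hdb' := hp.inner_sub_nonpos hb'
  have k := key _ _ _ _ _ _ _ hua hub hdet hda hdb
  have k' := key _ _ _ _ _ _ _ hua' hub' hdet' hda' hdb'
  -- Exchanging `x` and `x'` reverses the displacement, so both signs are excluded.
  have hd : (x' 1 - x 1) = s * (x' 0 - x 0) := by
    cases σ <;> simp only [if_true, Bool.false_eq_true, if_false] at k k' <;> linarith
  have e0 : x' 0 - x 0 = 0 := by
    rw [hd] at hda hdb
    have h1 : (x' 0 - x 0) * ((c a 0 - c p 0) + s * (c a 1 - c p 1)) ≤ 0 := by linarith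
    have h2 : (x' 0 - x 0) * ((c b 0 - c p 0) + s * (c b 1 - c p 1)) ≤ 0 := by linarith
    exact le_antisymm (nonpos_of_mul_nonpos_left h2 hub)
      (by by_contra! hneg; linarith [mul_pos_of_neg_of_neg hneg hua])
  have e1 : x' 1 - x 1 = 0 := by rw [hd, e0, mul_zero]
  ext i
  fin_cases i
  · exact (sub_eq_zero.1 e0).symm
  · exact (sub_eq_zero.1 e1).symm

theorem exists_separating_slope [Finite ι] (c : ι → Plane) :
    ∃ s : ℝ, ∀ i j, c i 0 + s * c i 1 = c j 0 + s * c j 1 → c i = c j := by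
  -- Finitely many slopes are bad; a zero denominator merely excludes the slope 0 as well.
  obtain ⟨s, hs⟩ := (Set.finite_range fun p : ι × ι =>
    -(c p.1 0 - c p.2 0) / (c p.1 1 - c p.2 1)).infinite_compl.nonempty
  refine ⟨s, fun i j h => ?_⟩
  have e1 : c i 1 = c j 1 := by
    by_contra hne
    refine hs ⟨(i, j), ?_⟩
    have : c i 1 - c j 1 ≠ 0 := sub_ne_zero.2 hne
    field_simp
    linarith
  have e0 : c i 0 = c j 0 := by
    rw [e1] at h
    linarith
  ext k
  fin_cases k
  · exact e0
  · exact e1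

theorem IsSurrounded.exists_isMiddle [Finite ι] {c : ι → Plane} {r : ι → ℝ} {s : ℝ}
    (hs : ∀ i j, c i 0 + s * c i 1 = c j 0 + s * c j 1 → c i = c j) {x : Plane}
    (hx : IsSurrounded c r x) : ∃ z : ι × Bool, IsMiddle c r s x z.1 z.2 := by
  obtain ⟨j₀, hj₀, -⟩ := hx 1 0 (by simp)
  have hne : {i | IsActive c r x i}.Nonempty := ⟨j₀, hj₀⟩
  obtain ⟨a, ha, hamin⟩ := Set.exists_min_image {i | IsActive c r x i}
    (fun i => c i 0 + s * c i 1) (Set.toFinite _) hne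
  obtain ⟨b, hb, hbmax⟩ := Set.exists_max_image {i | IsActive c r x i}
    (fun i => c i 0 + s * c i 1) (Set.toFinite _) hne
  obtain ⟨v0, v1, hv, hvab⟩ : ∃ v0 v1 : ℝ, (v0 ≠ 0 ∨ v1 ≠ 0) ∧
      v0 * (c b 0 - c a 0) + v1 * (c b 1 - c a 1) = 0 := by
    by_cases h : c b 0 - c a 0 = 0 ∧ c b 1 - c a 1 = 0
    · exact ⟨1, 0, by simp, by rw [h.1, h.2]; ring⟩
    · refine ⟨-(c b 1 - c a 1), c b 0 - c a 0, ?_, by ring⟩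
      rw [not_and_or] at h
      rw [neg_ne_zero]
      exact h.symm
  -- Active centres on both sides of `x` along `v` cannot all lie on one line normal to `v`.
  obtain ⟨p, hp, hpne⟩ : ∃ p, IsActive c r x p ∧
      v0 * (c p 0 - c a 0) + v1 * (c p 1 - c a 1) ≠ 0 := by
    by_contra! hcon
    obtain ⟨j, hj, hj'⟩ := hx v0 v1 hv
    obtain ⟨k, hk, hk'⟩ := hx (-v0) (-v1) (by simpa using hv)
    have h1 := hcon j hj
    have h2 := hcon k hk
    linarith
  have hpa : c a 0 + s * c a 1 < c p 0 + s * c p 1 := by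
    refine lt_of_le_of_ne (hamin p hp) fun h => hpne ?_
    rw [hs _ _ h]
    ring
  have hpb : c p 0 + s * c p 1 < c b 0 + s * c b 1 := by
    refine lt_of_le_of_ne (hbmax p hp) fun h => hpne ?_
    rw [hs _ _ h]
    exact hvab
  have hdet : (c b 0 - c p 0) * (c a 1 - c p 1) - (c a 0 - c p 0) * (c b 1 - c p 1) ≠ 0 := by
    intro h
    have h0 : (v0 * (c p 0 - c a 0) + v1 * (c p 1 - c a 1)) * (c b 0 - c a 0) = 0 := by
      linear_combination (c p 0 - c a 0) * hvab - v1 * h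
    have h1 : (v0 * (c p 0 - c a 0) + v1 * (c p 1 - c a 1)) * (c b 1 - c a 1) = 0 := by
      linear_combination (c p 1 - c a 1) * hvab + v0 * h
    have h2 := (mul_eq_zero.1 h0).resolve_left hpne
    have h3 := (mul_eq_zero.1 h1).resolve_left hpne
    have h4 : c b 0 = c a 0 := by linarith
    have h5 : c b 1 = c a 1 := by linarith
    rw [h4, h5] at hpb
    linarith
  rcases hdet.lt_or_gt with h | h
  · exact ⟨(p, false), hp, a, b, ha, hb, by linarith, by linarith, by
      simp only [Bool.false_eq_true, if_false]; linarith⟩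
  · exact ⟨(p, true), hp, a, b, ha, hb, by linarith, by linarith, by
      simp only [if_true]; linarith⟩

theorem finite_and_ncard_le_of_isSurrounded [Finite ι] [Nonempty ι] {α : Type*} {c : ι → Plane} {r : ι → ℝ}
    {A : Set α} {m : α → Plane} (hm : Set.InjOn m A) (h : ∀ q ∈ A, IsSurrounded c r (m q)) :
    A.Finite ∧ A.ncard ≤ 2 * Nat.card ι := by
  obtain ⟨s, hs⟩ := exists_separating_slope c
  choose! g hg using fun q hq => (h q hq).exists_isMiddle hs
  have hinj : Set.InjOn g A := by
    intro q hq q' hq' e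
    refine hm hq hq' ?_
    have h' := hg q' hq'
    rw [← e] at h'
    exact (hg q hq).eq h'
  have hfin : A.Finite := Set.Finite.of_finite_image (Set.toFinite (g '' A)) hinj
  refine ⟨hfin, ?_⟩
  rw [← hinj.ncard_image]
  refine (Set.ncard_le_card (g '' A)).trans ?_
  rw [Nat.card_prod]
  simp [mul_comm]

/-! ### Bounded and unbounded components -/

/-- A frontier point in `U` would have an open component meeting that of `x`, hence equal to it, and
so would be interior. -/
theorem disjoint_frontier_connectedComponentIn {α : Type*} [TopologicalSpace α]
    [LocallyConnectedSpace α] {U : Set α} (hU : IsOpen U) (x : α) :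
    Disjoint (frontier (connectedComponentIn U x)) U := by
  rw [Set.disjoint_left]
  intro y hy hyU
  have hyc := mem_connectedComponentIn hyU
  obtain ⟨z, hzy, hzx⟩ := mem_closure_iff.1 hy.1 _ hU.connectedComponentIn hyc
  rw [connectedComponentIn_eq hzy, ← connectedComponentIn_eq hzx] at hyc
  exact hy.2 (hU.connectedComponentIn.interior_eq.symm ▸ hyc)

/-- A continuous function that is positive exactly on `U` has a local maximum in every bounded
component of `U`. -/
theorem exists_isLocalMax_of_isBounded_component {f : Plane → ℝ} (hf : Continuous f) {q : Plane}
    (hq : 0 < f q) (hb : Bornology.IsBounded (connectedComponentIn {y | 0 < f y} q)) :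
    ∃ x ∈ connectedComponentIn {y | 0 < f y} q, IsLocalMax f x := by
  have hU : IsOpen {y | 0 < f y} := isOpen_lt continuous_const hf
  have hqF := mem_connectedComponentIn (F := {y | 0 < f y}) hq
  obtain ⟨x, hx, hmax⟩ := hb.isCompact_closure.exists_isMaxOn ⟨q, subset_closure hqF⟩
    hf.continuousOn
  have hxU : 0 < f x := hq.trans_le (hmax (subset_closure hqF))
  have hxF : x ∈ connectedComponentIn {y | 0 < f y} q := by
    by_contra hn
    refine Set.disjoint_left.1 (disjoint_frontier_connectedComponentIn hU q) ⟨hx, ?_⟩ hxU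
    exact fun h => hn (interior_subset h)
  exact ⟨x, hxF, Filter.mem_of_superset (hU.connectedComponentIn.mem_nhds hxF)
    fun y hy => hmax (subset_closure hy)⟩

theorem isPreconnected_norm_gt (ρ : ℝ) (hρ : 0 ≤ ρ) : IsPreconnected {y : Plane | ρ < ‖y‖} := by
  have hrank : 1 < Module.rank ℝ Plane := by
    rw [← Module.finrank_eq_rank, finrank_euclideanSpace_fin]
    norm_num
  have hS : IsPreconnected (Metric.sphere (0 : Plane) 1) :=
    (isConnected_sphere hrank 0 zero_le_one).isPreconnected
  -- Polar coordinates: the image of a connected product.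
  have himg : {y : Plane | ρ < ‖y‖} =
      (fun z : ℝ × Plane => z.1 • z.2) '' (Set.Ioi ρ ×ˢ Metric.sphere (0 : Plane) 1) := by
    ext y
    constructor
    · intro hy
      have hy : ρ < ‖y‖ := hy
      have hpos : ‖y‖ ≠ 0 := (hρ.trans_lt hy).ne'
      refine ⟨(‖y‖, ‖y‖⁻¹ • y), ⟨hy, ?_⟩, smul_inv_smul₀ hpos y⟩
      simp [norm_smul, hpos]
    · rintro ⟨⟨t, z⟩, ⟨ht, hz⟩, rfl⟩
      have ht : ρ < t := ht
      have hz : ‖z‖ = 1 := by simpa using hz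
      simpa [norm_smul, hz, abs_of_pos (hρ.trans_lt ht)] using ht
  rw [himg]
  exact (isPreconnected_Ioi.prod hS).image _ (by fun_prop)

theorem connectedComponentIn_eq_of_not_isBounded {U : Set Plane} {ρ : ℝ} (hρ : 0 ≤ ρ)
    (hU : {y : Plane | ρ < ‖y‖} ⊆ U) {q q' : Plane}
    (h : ¬ Bornology.IsBounded (connectedComponentIn U q))
    (h' : ¬ Bornology.IsBounded (connectedComponentIn U q')) :
    connectedComponentIn U q = connectedComponentIn U q' := by
  have hfar : ∀ q, ¬ Bornology.IsBounded (connectedComponentIn U q) →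
      ∃ y ∈ connectedComponentIn U q, ρ < ‖y‖ := by
    intro q hq
    by_contra! hcon
    exact hq (isBounded_iff_forall_norm_le.2 ⟨ρ, hcon⟩)
  obtain ⟨y, hy, hyρ⟩ := hfar q h
  obtain ⟨y', hy', hyρ'⟩ := hfar q' h'
  have := (isPreconnected_norm_gt ρ hρ).subset_connectedComponentIn hyρ hU hyρ'
  rw [connectedComponentIn_eq hy, connectedComponentIn_eq this, ← connectedComponentIn_eq hy']

theorem mainTheorem3 :
    ∃ c : ℝ, 0 < c ∧
      ∀ (R : Set (Set Plane)) (Q : Set Plane),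
        R.Finite → R.Nonempty → (∀ d ∈ R, IsDisk d) →
        (∀ q ∈ Q, ∀ d ∈ R, q ∉ d) →
        (∀ F : Set Plane, IsFace R F → (Q ∩ F).Subsingleton) →
        Q.Finite ∧ c * (Q.ncard : ℝ) ≤ (R.ncard : ℝ) := by
  -- Bounded faces cost `2|R|`, the unbounded one costs `1 ≤ |R|`.
  refine ⟨1 / 3, by norm_num, fun R Q hRfin hRne hdisk hQ hface => ?_⟩
  choose c r hr hd using fun d : R => hdisk d d.2
  have := hRfin.fintype
  have := hRne.to_subtype
  have hU : unionCompl R = {y | 0 < minPower c r y} := by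
    ext y
    simp only [unionCompl, Set.mem_compl_iff, Set.mem_iUnion, not_exists, Set.mem_ofPred_eq,
      minPower, Finset.lt_inf'_iff, Finset.mem_univ, true_imp_iff]
    have hmem : ∀ d : R, 0 < power (c d) (r d) y ↔ y ∉ (d : Set Plane) := fun d => by
      rw [← not_le, power_nonpos_iff (hr d), ← hd d]
    exact ⟨fun h d => (hmem d).2 (h d d.2), fun h d hdR => (hmem ⟨d, hdR⟩).1 (h ⟨d, hdR⟩)⟩
  have hQU : ∀ q ∈ Q, q ∈ unionCompl R := fun q hq => by
    simpa [unionCompl] using hQ q hq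
  have heq : ∀ q ∈ Q, ∀ q' ∈ Q, connectedComponentIn (unionCompl R) q =
      connectedComponentIn (unionCompl R) q' → q = q' := fun q hq q' hq' e =>
    hface _ ⟨q, hQU q hq, rfl⟩ ⟨hq, mem_connectedComponentIn (hQU q hq)⟩
      ⟨hq', e ▸ mem_connectedComponentIn (hQU q' hq')⟩
  set B := {q | Bornology.IsBounded (connectedComponentIn (unionCompl R) q)} with hB
  have hmax : ∀ q ∈ Q ∩ B, ∃ x ∈ connectedComponentIn (unionCompl R) q,
      IsLocalMax (minPower c r) x := by
    intro q hq
    have hqB := hq.2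
    have hqU := hQU q hq.1
    rw [hB, Set.mem_ofPred_eq, hU] at hqB
    rw [hU] at hqU ⊢
    exact exists_isLocalMax_of_isBounded_component (continuous_minPower c r) hqU hqB
  choose! m hm hmloc using hmax
  have hminj : Set.InjOn m (Q ∩ B) := fun q hq q' hq' e => by
    refine heq q hq.1 q' hq'.1 ?_
    have h' := hm q' hq'
    rw [← e] at h'
    rw [connectedComponentIn_eq (hm q hq), connectedComponentIn_eq h']
  obtain ⟨hfin, hcard⟩ := finite_and_ncard_le_of_isSurrounded hminj
    fun q hq => (hmloc q hq).isSurrounded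
  obtain ⟨ρ, hρ⟩ : ∃ ρ : ℝ, ∀ d ∈ R, ∀ y ∈ d, ‖y‖ ≤ ρ := by
    have hbdd : Bornology.IsBounded (⋃ d ∈ R, d) := by
      refine (Bornology.isBounded_biUnion hRfin).2 fun d hdR => ?_
      obtain ⟨c, r, -, rfl⟩ := hdisk d hdR
      exact Metric.isBounded_closedBall
    obtain ⟨ρ, hρ⟩ := isBounded_iff_forall_norm_le.1 hbdd
    exact ⟨ρ, fun d hdR y hy => hρ y (Set.mem_biUnion hdR hy)⟩
  have hout : {y : Plane | max ρ 0 < ‖y‖} ⊆ unionCompl R := by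
    intro y hy
    simp only [unionCompl, Set.mem_compl_iff, Set.mem_iUnion, not_exists]
    exact fun d hdR hyd => not_le_of_gt ((le_max_left ρ 0).trans_lt hy) (hρ d hdR y hyd)
  have hsub : (Q \ B).Subsingleton := fun q hq q' hq' => heq q hq.1 q' hq'.1
    (connectedComponentIn_eq_of_not_isBounded (le_max_right ρ 0) hout hq.2 hq'.2)
  have hQeq : (Q ∩ B) ∪ (Q \ B) = Q := Set.inter_union_sdiff Q B
  have hcount : Q.ncard ≤ 3 * R.ncard := by
    have h1 := Set.ncard_union_le (Q ∩ B) (Q \ B)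
    have := hsub.finite.to_subtype
    have h2 := Set.ncard_le_one_iff_subsingleton.2 hsub
    have h3 : 0 < R.ncard := (Set.ncard_pos hRfin).2 hRne
    rw [hQeq] at h1
    rw [Nat.card_coe_set_eq] at hcard
    omega
  refine ⟨hQeq ▸ hfin.union hsub.finite, ?_⟩
  have : (Q.ncard : ℝ) ≤ 3 * R.ncard := by exact_mod_cast hcount
  linarith
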